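/- Let $d\ge 1$ be an integer, let $t\in(0,\infty)$, and let $\mathbb B_d$ be the open unit ball of $\mathbb C^d$. Let $\mathcal H=\mathcal H_d^t$ be the Hilbert function space (reproducing kernel Hilbert space) on $\mathbb B_d$ with kernel $$k(x,y)=k_y(x)=\frac1{(1-\langle x,y\rangle)^{t}}\qquad(x,y\in\mathbb B_d),$$ where the power is defined by the principal branch of the logarithm. For $A\subset\mathbb B_d$ put $\mathcal H_A=\overline{\operatorname{span}}\{k_a: a\in A\}\subset\mathcal H$, a Hilbert function space on $A$. For $A,B\subset\mathbb B_d$, a map $\phi:A\to B$ is said to induce an isometric isomorphism $\mathcal H_A\to\mathcal H_B$ if there are a surjective linear isometry $T:\mathcal H_A\to\mathcal H_B$ and a function $f:A\to\mathbb C$ with $T k_a=f(a)\,k_{\phi(a)}$ for all $a\in A$; the spaces $\mathcal H_A$ and $\mathcal H_B$ are isometric (as Hilbert function spaces) if some bijection $\phi:A\to B$ induces an isometric isomorphism. The sets $A$ and $B$ are congruent if some biholomorphic automorphism of $\mathbb B_d$ maps $A$ onto $B$. The space $\mathcal H$ is faithful if for all $A,B\subset\mathbb B_d$ every map $\phi:A\to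 B$ that induces an isometric isomorphism $\mathcal H_A\to\mathcal H_B$ extends to a biholomorphic automorphism of $\mathbb B_d$. Then: 1. If $t\le 2$, then for all $A,B\subset\mathbb B_d$ the spaces $\mathcal H_A$ and $\mathcal H_B$ are isometric if and only if $A$ and $B$ are congruent. 2. If $t>2$, there exist non-congruent $A,B\subset\mathbb B_d$ such that $\mathcal H_A$ and $\mathcal H_B$ are isometric. 3. $\mathcal H$ is faithful if and only if $t\le 2$. -/

import Mathlib

open scoped InnerProductSpace ComplexConjugate

noncomputable section

/-! ### Hilbert function spaces and their isometries -/

section HilbertFunctionSpaces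

variable {X : Type*} (H : Type*) [NormedAddCommGroup H] [InnerProductSpace ℂ H]
  [RKHS ℂ H X ℂ] [CompleteSpace H]

/-- The kernel function `k_x ∈ H` of a Hilbert function space `H` of complex valued functions
on `X`, characterised by `⟨f, k_x⟩ = f x`. -/
def kernelFunction (x : X) : H := RKHS.kerFun H x (1 : ℂ)

theorem inner_kernelFunction (x : X) (f : H) : ⟪kernelFunction H x, f⟫_ℂ = f x := by
  simp [kernelFunction]

/-- `H_A`, the closed linear span of the kernel functions `k_a`, `a ∈ A`. -/
def kernelSubspace (A : Set X) : Submodule ℂ H :=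
  (Submodule.span ℂ (kernelFunction H '' A)).topologicalClosure

theorem kernelFunction_mem {A : Set X} (a : A) :
    kernelFunction H (a : X) ∈ kernelSubspace H A :=
  Submodule.le_topologicalClosure _ (Submodule.subset_span ⟨a, a.2, rfl⟩)

instance instCompleteSpaceKernelSubspace (A : Set X) : CompleteSpace (kernelSubspace H A) :=
  (Submodule.isClosed_topologicalClosure _).completeSpace_coe

/-- `H_A` is a Hilbert function space on `A`, an element being regarded as a function on `A` by
restriction. -/
instance instRKHSKernelSubspace (A : Set X) : RKHS ℂ (kernelSubspace H A) A ℂ where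
  coeCLM := (ContinuousLinearMap.pi fun a : A ↦
    (ContinuousLinearMap.proj (a : X) ∘L RKHS.coeCLM ℂ (H := H))) ∘L (kernelSubspace H A).subtypeL
  coeCLM_injective := by
    refine (injective_iff_map_eq_zero _).mpr fun f hf ↦ ?_
    have h0 : ∀ a ∈ A, (f : H) a = 0 := fun a ha ↦ congrFun hf ⟨a, ha⟩
    have h1 : kernelSubspace H A ≤ (ℂ ∙ (f : H))ᗮ := by
      refine Submodule.topologicalClosure_minimal _ (Submodule.span_le.mpr ?_)
        (Submodule.isClosed_orthogonal _)
      rintro _ ⟨a, ha, rfl⟩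
      rw [SetLike.mem_coe, Submodule.mem_orthogonal_singleton_iff_inner_left,
        inner_kernelFunction, h0 a ha]
    have h2 := Submodule.mem_orthogonal_singleton_iff_inner_left.mp (h1 f.2)
    exact Subtype.ext (inner_self_eq_zero.mp h2)

theorem kernelSubspace_apply {A : Set X} (f : kernelSubspace H A) (a : A) :
    f a = (f : H) (a : X) := rfl

/-- The kernel function of `H_A` at `a ∈ A` is the kernel function of `H` at `a`. -/
theorem kernelFunction_kernelSubspace {A : Set X} (a : A) :
    kernelFunction (kernelSubspace H A) a = ⟨kernelFunction H (a : X), kernelFunction_mem H a⟩ := by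
  refine ext_inner_right ℂ fun f ↦ ?_
  rw [inner_kernelFunction, kernelSubspace_apply, Submodule.coe_inner, inner_kernelFunction]

variable {Y : Type*} (E : Type*) [NormedAddCommGroup E] [InnerProductSpace ℂ E]
  [RKHS ℂ E Y ℂ] [CompleteSpace E]

/-- `φ : X → Y` induces an isometric isomorphism `T : H → E`: a surjective linear isometry with
`T k_x = f(x) k_{φ(x)}` for some scalar function `f` on `X`. -/
def InducesIsometricIso (φ : X → Y) : Prop :=
  ∃ T : H ≃ₗᵢ[ℂ] E, ∃ f : X → ℂ, ∀ x, T (kernelFunction H x) = f x • kernelFunction E (φ x)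

/-- `H` and `E` are isometric as Hilbert function spaces: there is an isometric isomorphism
induced by a bijection of the underlying sets. -/
def IsometricHFS : Prop :=
  ∃ φ : X → Y, Function.Bijective φ ∧ InducesIsometricIso H E φ

end HilbertFunctionSpaces

/-! ### The ball and its automorphisms -/

/-- The open unit ball of `ℂ^d`. -/
abbrev UnitBall (d : ℕ) : Type := Metric.ball (0 : EuclideanSpace ℂ (Fin d)) 1

/-- A self-map of the ball is holomorphic if it is complex differentiable on the ball, as a map
into `ℂ^d`; `F` only serves to write it as a map on all of `ℂ^d`. -/
def IsHolomorphicSelfMap {d : ℕ} (Φ : UnitBall d → UnitBall d) : Prop :=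
  ∃ F : EuclideanSpace ℂ (Fin d) → EuclideanSpace ℂ (Fin d),
    DifferentiableOn ℂ F (Metric.ball 0 1) ∧ ∀ x : UnitBall d, F x = Φ x

/-- Biholomorphic automorphisms of the ball. -/
structure BallAut (d : ℕ) extends UnitBall d ≃ UnitBall d where
  holomorphic : IsHolomorphicSelfMap toFun
  holomorphic_inv : IsHolomorphicSelfMap invFun

/-- Some biholomorphic automorphism of the ball maps `A` onto `B`. -/
def BallCongruent {d : ℕ} (A B : Set (UnitBall d)) : Prop :=
  ∃ Φ : BallAut d, Φ.toEquiv '' A = B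

/-! ### The space with kernel `(1 - ⟨x, y⟩)^{-t}` -/

/-- The kernel `k(x, y) = 1 / (1 - ⟨x, y⟩)^t` (principal branch). The inner product of `ℂ^d` is
linear in its first argument here, so `⟨x, y⟩` is `inner ℂ y x`. -/
def ballKernel (d : ℕ) (t : ℝ) (x y : UnitBall d) : ℂ :=
  1 / (1 - ⟪(y : EuclideanSpace ℂ (Fin d)), (x : EuclideanSpace ℂ (Fin d))⟫_ℂ) ^ (t : ℂ)

/-- The kernel as a matrix with entries in the operators on `ℂ` (multiplications by scalars). -/
def ballKernelMatrix (d : ℕ) (t : ℝ) : Matrix (UnitBall d) (UnitBall d) (ℂ →L[ℂ] ℂ) :=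
  .of fun x y ↦ ballKernel d t x y • ContinuousLinearMap.id ℂ ℂ

theorem norm_inner_unitBall_lt {d : ℕ} (x y : UnitBall d) :
    ‖⟪(y : EuclideanSpace ℂ (Fin d)), (x : EuclideanSpace ℂ (Fin d))⟫_ℂ‖ < 1 := by
  have hx : ‖(x : EuclideanSpace ℂ (Fin d))‖ < 1 := mem_ball_zero_iff.mp x.2
  have hy : ‖(y : EuclideanSpace ℂ (Fin d))‖ < 1 := mem_ball_zero_iff.mp y.2
  refine (norm_inner_le_norm _ _).trans_lt ?_
  nlinarith [norm_nonneg (x : EuclideanSpace ℂ (Fin d)),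
    norm_nonneg (y : EuclideanSpace ℂ (Fin d))]

theorem conj_ballKernel (d : ℕ) (t : ℝ) (x y : UnitBall d) :
    conj (ballKernel d t x y) = ballKernel d t y x := by
  have h := norm_inner_unitBall_lt x y
  have harg : (1 - ⟪(y : EuclideanSpace ℂ (Fin d)),
      (x : EuclideanSpace ℂ (Fin d))⟫_ℂ).arg ≠ Real.pi := by
    refine (Complex.mem_slitPlane_iff_arg.mp ?_).1
    rw [sub_eq_add_neg]
    exact Complex.mem_slitPlane_of_norm_lt_one (by rwa [norm_neg])
  have hc : conj ((1 - ⟪(y : EuclideanSpace ℂ (Fin d)), (x : EuclideanSpace ℂ (Fin d))⟫_ℂ) ^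
      (t : ℂ)) = (1 - ⟪(x : EuclideanSpace ℂ (Fin d)), (y : EuclideanSpace ℂ (Fin d))⟫_ℂ) ^
      (t : ℂ) := by
    have := Complex.conj_cpow _ (t : ℂ) harg
    rw [Complex.conj_ofReal] at this
    rw [← this, map_sub, map_one, inner_conj_symm]
  rw [ballKernel, ballKernel, map_div₀, map_one, hc]

theorem hasSum_ballKernel (d : ℕ) (t : ℝ) (x y : UnitBall d) :
    HasSum (fun n : ℕ ↦ ((Ring.multichoose t n : ℝ) : ℂ) *
      ⟪(y : EuclideanSpace ℂ (Fin d)), (x : EuclideanSpace ℂ (Fin d))⟫_ℂ ^ n)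
      (ballKernel d t x y) := by
  have h := (Complex.one_div_one_sub_cpow_hasFPowerSeriesOnBall_zero (t : ℂ)).hasSum
    (y := ⟪(y : EuclideanSpace ℂ (Fin d)), (x : EuclideanSpace ℂ (Fin d))⟫_ℂ) (by
      simpa [enorm_eq_nnnorm] using! norm_inner_unitBall_lt x y)
  rw [zero_add] at h
  have he : ∀ n : ℕ, ((Ring.multichoose t n : ℝ) : ℂ) = Ring.choose ((t : ℂ) + n - 1) n := by
    intro n
    rw [← Ring.multichoose_eq]
    exact Ring.map_multichoose Complex.ofRealHom t n
  simpa only [he, FormalMultilinearSeries.ofScalars_apply_eq, smul_eq_mul, ballKernel] using h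

theorem multichoose_nonneg_of_pos {t : ℝ} (ht : 0 < t) (n : ℕ) : 0 ≤ Ring.multichoose t n := by
  have h := Ring.factorial_nsmul_multichoose_eq_ascPochhammer t n
  rw [Polynomial.ascPochhammer_smeval_eq_eval, nsmul_eq_mul] at h
  have h1 := ascPochhammer_pos n t ht
  rw [← h] at h1
  exact (pos_of_mul_pos_right h1 (Nat.cast_nonneg _)).le

theorem re_sum_inner_pow_nonneg {d : ℕ} (s : Finset (UnitBall d)) (n : ℕ)
    (c : UnitBall d → ℂ) :
    0 ≤ (∑ x ∈ s, ∑ y ∈ s, conj (c x) * c y *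
      ⟪(y : EuclideanSpace ℂ (Fin d)), (x : EuclideanSpace ℂ (Fin d))⟫_ℂ ^ n).re := by
  induction n generalizing c with
  | zero =>
    have : ∑ x ∈ s, ∑ y ∈ s, conj (c x) * c y *
        ⟪(y : EuclideanSpace ℂ (Fin d)), (x : EuclideanSpace ℂ (Fin d))⟫_ℂ ^ 0 =
        conj (∑ x ∈ s, c x) * ∑ y ∈ s, c y := by
      simp only [pow_zero, mul_one, map_sum, Finset.sum_mul_sum]
    rw [this, ← Complex.normSq_eq_conj_mul_self, Complex.ofReal_re]
    exact Complex.normSq_nonneg _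
  | succ n ih =>
    have : ∑ x ∈ s, ∑ y ∈ s, conj (c x) * c y *
        ⟪(y : EuclideanSpace ℂ (Fin d)), (x : EuclideanSpace ℂ (Fin d))⟫_ℂ ^ (n + 1) =
        ∑ i : Fin d, ∑ x ∈ s, ∑ y ∈ s,
          conj (c x * conj (x.1 i)) * (c y * conj (y.1 i)) *
          ⟪(y : EuclideanSpace ℂ (Fin d)), (x : EuclideanSpace ℂ (Fin d))⟫_ℂ ^ n := by
      rw [Finset.sum_comm (s := Finset.univ)]
      refine Finset.sum_congr rfl fun x _ ↦ ?_
      rw [Finset.sum_comm (s := Finset.univ)]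
      refine Finset.sum_congr rfl fun y _ ↦ ?_
      rw [pow_succ]
      nth_rewrite 2 [PiLp.inner_apply]
      rw [Finset.mul_sum, Finset.mul_sum]
      refine Finset.sum_congr rfl fun i _ ↦ ?_
      simp only [RCLike.inner_apply, map_mul, Complex.conj_conj]
      ring
    rw [this, Complex.re_sum]
    exact Finset.sum_nonneg fun i _ ↦ ih _

theorem posSemidef_ballKernelMatrix (d : ℕ) {t : ℝ} (ht : 0 < t) :
    (ballKernelMatrix d t).PosSemidef := by
  have key := (RKHS.posSemidef_tfae (K := ballKernelMatrix d t)).out 0 2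
  refine key.mpr ⟨?_, fun c ↦ ?_⟩
  · ext x y
    simp [ballKernelMatrix, ContinuousLinearMap.star_eq_adjoint, conj_ballKernel,
      ContinuousLinearMap.adjoint_id]
  · have hs : HasSum (fun n : ℕ ↦ Ring.multichoose t n *
        (∑ x ∈ c.support, ∑ y ∈ c.support, conj (c x) * c y *
          ⟪(y : EuclideanSpace ℂ (Fin d)), (x : EuclideanSpace ℂ (Fin d))⟫_ℂ ^ n).re)
        (∑ x ∈ c.support, ∑ y ∈ c.support, conj (c x) * c y * ballKernel d t x y).re := by
      have h := hasSum_sum fun x (_ : x ∈ c.support) ↦ hasSum_sum fun y (_ : y ∈ c.support) ↦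
        (hasSum_ballKernel d t x y).mul_left (conj (c x) * c y)
      convert Complex.hasSum_re h using 2 with n
      rw [← Complex.re_ofReal_mul, Finset.mul_sum]
      simp only [Finset.mul_sum]
      congr 1
      refine Finset.sum_congr rfl fun x _ ↦ Finset.sum_congr rfl fun y _ ↦ ?_
      ring
    have h0 := hs.nonneg fun n ↦
      mul_nonneg (multichoose_nonneg_of_pos ht n) (re_sum_inner_pow_nonneg c.support n c)
    have he : (c.sum fun x w ↦ c.sum fun y w' ↦ ⟪ballKernelMatrix d t y x w, w'⟫_ℂ) =
        ∑ x ∈ c.support, ∑ y ∈ c.support, conj (c x) * c y * ballKernel d t x y := by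
      refine Finset.sum_congr rfl fun x _ ↦ Finset.sum_congr rfl fun y _ ↦ ?_
      simp [ballKernelMatrix, conj_ballKernel]
      ring
    rw [he]
    exact h0

instance instFactPosSemidefBallKernelMatrix (d : ℕ) (t : ℝ) [Fact (0 < t)] :
    Fact (ballKernelMatrix d t).PosSemidef :=
  ⟨posSemidef_ballKernelMatrix d Fact.out⟩

/-- The Hilbert function space on the unit ball of `ℂ^d` with kernel `ballKernel d t`. -/
abbrev BallSpace (d : ℕ) (t : ℝ) [Fact (0 < t)] : Type :=
  RKHS.OfKernel (ballKernelMatrix d t)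

theorem kernelFunction_ballSpace_apply (d : ℕ) (t : ℝ) [Fact (0 < t)] (x y : UnitBall d) :
    kernelFunction (BallSpace d t) y x = ballKernel d t x y := by
  rw [kernelFunction, RKHS.kerFun_apply, RKHS.OfKernel.kernel_ofKernel]
  simp [ballKernelMatrix]

/-- `BallSpace d t` is faithful: every map `φ : A → B` between subsets of the ball that induces
an isometric isomorphism of the associated subspaces extends to an automorphism of the ball. -/
def IsFaithful (d : ℕ) (t : ℝ) [Fact (0 < t)] : Prop :=
  ∀ (A B : Set (UnitBall d)) (φ : A → B),
    InducesIsometricIso (kernelSubspace (BallSpace d t) A) (kernelSubspace (BallSpace d t) B) φ →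
      ∃ Φ : BallAut d, ∀ a : A, Φ.toEquiv a = φ a

end

noncomputable section

/-! ### Isometries determined by Gram matrices -/

section Gram

variable {ι E F : Type*} [NormedAddCommGroup E] [InnerProductSpace ℂ E]
  [NormedAddCommGroup F] [InnerProductSpace ℂ F]

/-! A map `φ` induces an isometric isomorphism only if `k(x, y) = conj (f x) * f y * k(φ x, φ y)`
for some `f`; for surjective `φ` and nonvanishing `f` this also suffices, because the Gram matrix of
a family with dense span determines the space.

Automorphisms rescale the kernel. For the involution exchanging `a` and `0`
(`one_sub_inner_ballInvolution`), `1 - ⟨x, y⟩` changes by a function of `x` times a conjugate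
function of `y`, and connectedness of the ball carries this over to principal powers. By the Schwarz
lemma an automorphism fixing `0` is linear and isometric, so every automorphism is such a map
followed by an involution.

Conversely, let `φ` rescale the kernel. Involutions move a base point and its image to `0`, where
the kernel is `1`; the rescaling then becomes trivial and `(1 - ⟨x, y⟩)^t` is preserved. If `t ≤ 2`,
then `z ↦ z^t` is injective on the right half plane, so inner products are preserved and a unitary
map extends the correspondence.

If `t > 2`, the distinct points `cos(π/t) e^{±iπ/t}` have the same `t`-th power. A triangle `0, a,
b` whose `1 - ⟨a, b⟩` is such a point has a real kernel, hence is isometric to its complex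
conjugate. When it is scalene, a congruence with the conjugate would force `⟨a, b⟩` to be real. This
also refutes faithfulness. -/

theorem norm_linearCombination_eq_of_gram_eq {v : ι → E} {w : ι → F}
    (h : ∀ i j, ⟪v i, v j⟫_ℂ = ⟪w i, w j⟫_ℂ) (c : ι →₀ ℂ) :
    ‖Finsupp.linearCombination ℂ w c‖ = ‖Finsupp.linearCombination ℂ v c‖ := by
  have : ⟪Finsupp.linearCombination ℂ w c, Finsupp.linearCombination ℂ w c⟫_ℂ =
      ⟪Finsupp.linearCombination ℂ v c, Finsupp.linearCombination ℂ v c⟫_ℂ := by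
    simp only [Finsupp.linearCombination_apply, Finsupp.sum, sum_inner, inner_sum, inner_smul_left,
      inner_smul_right, h]
  rw [@norm_eq_sqrt_re_inner ℂ, this, ← @norm_eq_sqrt_re_inner ℂ]

/-- Equal Gram matrices make `∑ cᵢ vᵢ ↦ ∑ cᵢ wᵢ` norm preserving, hence well defined even for
dependent `vᵢ`; it extends by density. -/
theorem exists_linearIsometry_of_gram_eq [CompleteSpace F] {v : ι → E} {w : ι → F}
    (hv : DenseRange (Finsupp.linearCombination ℂ v))
    (h : ∀ i j, ⟪v i, v j⟫_ℂ = ⟪w i, w j⟫_ℂ) :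
    ∃ L : E →ₗᵢ[ℂ] F, ∀ i, L (v i) = w i := by
  have hn := norm_linearCombination_eq_of_gram_eq h
  set L := (Finsupp.linearCombination ℂ w).extendOfNorm (Finsupp.linearCombination ℂ v)
  have hL : ∀ c, L (Finsupp.linearCombination ℂ v c) = Finsupp.linearCombination ℂ w c :=
    LinearMap.extendOfNorm_eq hv ⟨1, fun c ↦ by rw [hn, one_mul]⟩
  refine ⟨⟨L.toLinearMap, fun x ↦ ?_⟩, fun i ↦ ?_⟩
  · refine hv.induction_on (p := fun x ↦ ‖L x‖ = ‖x‖) x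
      (isClosed_eq (by fun_prop) (by fun_prop)) fun c ↦ ?_
    rw [hL, hn]
  · simpa using hL (Finsupp.single i 1)

theorem exists_linearIsometryEquiv_of_gram_eq [CompleteSpace E] [CompleteSpace F]
    {v : ι → E} {w : ι → F} (hv : DenseRange (Finsupp.linearCombination ℂ v))
    (hw : DenseRange (Finsupp.linearCombination ℂ w))
    (h : ∀ i j, ⟪v i, v j⟫_ℂ = ⟪w i, w j⟫_ℂ) :
    ∃ L : E ≃ₗᵢ[ℂ] F, ∀ i, L (v i) = w i := by
  obtain ⟨L, hL⟩ := exists_linearIsometry_of_gram_eq hv h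
  have hcl : IsClosed (Set.range L) := L.isometry.isClosedEmbedding.isClosed_range
  have hsub : Set.range (Finsupp.linearCombination ℂ w) ⊆ Set.range L := by
    rintro _ ⟨c, rfl⟩
    refine ⟨Finsupp.linearCombination ℂ v c, ?_⟩
    simp [Finsupp.linearCombination_apply, Finsupp.sum, hL]
  have hs : Function.Surjective L := by
    rw [← Set.range_eq_univ, ← hcl.closure_eq]
    exact (hw.mono hsub).closure_eq
  exact ⟨LinearIsometryEquiv.ofSurjective L hs, hL⟩

/-- Neither family has to span: the isometry defined on the span of `v` extends to all of `E`
because the dimension is finite. -/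
theorem exists_linearIsometryEquiv_extension_of_gram_eq [FiniteDimensional ℂ E] {v w : ι → E}
    (h : ∀ i j, ⟪v i, v j⟫_ℂ = ⟪w i, w j⟫_ℂ) :
    ∃ U : E ≃ₗᵢ[ℂ] E, ∀ i, U (v i) = w i := by
  have := FiniteDimensional.complete ℂ E
  let S := Submodule.span ℂ (Set.range v)
  let v' : ι → S := fun i ↦ ⟨v i, Submodule.subset_span ⟨i, rfl⟩⟩
  have hv : Function.Surjective (Finsupp.linearCombination ℂ v') := by
    rintro ⟨x, hx⟩
    obtain ⟨c, hc⟩ := Finsupp.mem_span_range_iff_exists_finsupp.mp hx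
    refine ⟨c, Subtype.ext ?_⟩
    simpa [Finsupp.linearCombination_apply, Finsupp.sum, v'] using hc
  obtain ⟨L, hL⟩ := exists_linearIsometry_of_gram_eq (v := v') (w := w) hv.denseRange
    fun i j ↦ h i j
  refine ⟨L.extend.toLinearIsometryEquiv rfl, fun i ↦ ?_⟩
  rw [← hL, LinearIsometry.coe_toLinearIsometryEquiv]
  exact L.extend_apply (v' i)

end Gram

/-! ### Isometric isomorphisms as rescalings of kernels -/

section HilbertFunctionSpaceMaps

variable {X Y : Type*} {H E : Type*} [NormedAddCommGroup H] [InnerProductSpace ℂ H]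
  [RKHS ℂ H X ℂ] [CompleteSpace H] [NormedAddCommGroup E] [InnerProductSpace ℂ E]
  [RKHS ℂ E Y ℂ] [CompleteSpace E]

/-- An element orthogonal to all these vectors is a function vanishing at every point of `X`. -/
theorem denseRange_linearCombination_of_surjective {Z : Type*} {φ : Z → X}
    (hφ : Function.Surjective φ) {f : Z → ℂ} (hf : ∀ z, f z ≠ 0) :
    DenseRange (Finsupp.linearCombination ℂ fun z ↦ f z • kernelFunction H (φ z)) := by
  have h : (LinearMap.range
      (Finsupp.linearCombination ℂ fun z ↦ f z • kernelFunction H (φ z))).topologicalClosure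
      = ⊤ := by
    rw [Submodule.topologicalClosure_eq_top_iff, Submodule.eq_bot_iff]
    intro g hg
    refine RKHS.ext (𝕜 := ℂ) fun x ↦ ?_
    obtain ⟨z, rfl⟩ := hφ x
    have := hg _ ⟨Finsupp.single z 1, rfl⟩
    simpa [inner_smul_left, inner_kernelFunction, hf z] using this
  rw [← Submodule.dense_iff_topologicalClosure_eq_top] at h
  exact h

/-- A map that rescales the kernel of `H` to that of `E` by a nonvanishing factor induces an
isometric isomorphism. -/
theorem inducesIsometricIso_of_rescaling {φ : X → Y} (hφ : Function.Surjective φ) {f : X → ℂ}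
    (hf : ∀ x, f x ≠ 0)
    (h : ∀ x y, kernelFunction H y x = conj (f x) * f y * kernelFunction E (φ y) (φ x)) :
    InducesIsometricIso H E φ := by
  obtain ⟨T, hT⟩ := exists_linearIsometryEquiv_of_gram_eq
    (v := fun x : X ↦ (1 : ℂ) • kernelFunction H x)
    (w := fun x : X ↦ f x • kernelFunction E (φ x))
    (denseRange_linearCombination_of_surjective Function.surjective_id fun _ ↦ one_ne_zero)
    (denseRange_linearCombination_of_surjective hφ hf) fun x y ↦ by
      rw [one_smul, one_smul, inner_kernelFunction, h, inner_smul_left, inner_smul_right,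
        inner_kernelFunction, mul_assoc]
  exact ⟨T, f, fun x ↦ by simpa using hT x⟩

theorem InducesIsometricIso.exists_rescaling {φ : X → Y} (h : InducesIsometricIso H E φ) :
    ∃ f : X → ℂ, ∀ x y,
      kernelFunction H y x = conj (f x) * f y * kernelFunction E (φ y) (φ x) := by
  obtain ⟨T, f, hT⟩ := h
  refine ⟨f, fun x y ↦ ?_⟩
  rw [← inner_kernelFunction, ← T.inner_map_map, hT, hT, inner_smul_left, inner_smul_right,
    inner_kernelFunction, mul_assoc]

end HilbertFunctionSpaceMaps

section BallSpaceMaps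

variable {d : ℕ} {t : ℝ} [Fact (0 < t)]

theorem kernelFunction_kernelSubspace_ballSpace {A : Set (UnitBall d)} (a b : A) :
    kernelFunction (kernelSubspace (BallSpace d t) A) b a = ballKernel d t a b := by
  rw [kernelSubspace_apply, kernelFunction_kernelSubspace, kernelFunction_ballSpace_apply]

theorem inducesIsometricIso_ballSpace_of_rescaling {A B : Set (UnitBall d)} {φ : A → B}
    (hφ : Function.Surjective φ) {f : A → ℂ} (hf : ∀ x, f x ≠ 0)
    (h : ∀ x y : A, ballKernel d t x y = conj (f x) * f y * ballKernel d t (φ x) (φ y)) :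
    InducesIsometricIso (kernelSubspace (BallSpace d t) A) (kernelSubspace (BallSpace d t) B) φ :=
  inducesIsometricIso_of_rescaling hφ hf fun x y ↦ by
    simp only [kernelFunction_kernelSubspace_ballSpace, h x y]

theorem exists_rescaling_of_inducesIsometricIso_ballSpace {A B : Set (UnitBall d)} {φ : A → B}
    (h : InducesIsometricIso (kernelSubspace (BallSpace d t) A)
      (kernelSubspace (BallSpace d t) B) φ) :
    ∃ f : A → ℂ, ∀ x y : A,
      ballKernel d t x y = conj (f x) * f y * ballKernel d t (φ x) (φ y) := by
  simpa only [kernelFunction_kernelSubspace_ballSpace] using h.exists_rescaling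

end BallSpaceMaps

/-! ### Möbius maps of the ball -/

section Moebius

variable {E : Type*} [NormedAddCommGroup E] [InnerProductSpace ℂ E]

/-- The involution of the unit ball of `E` that exchanges `a` and `0`. -/
def ballInvolution (a x : E) : E :=
  (1 - ⟪a, x⟫_ℂ)⁻¹ •
    ((1 - ⟪a, x⟫_ℂ / (1 + (√(1 - ‖a‖ ^ 2) : ℂ))) • a - (√(1 - ‖a‖ ^ 2) : ℂ) • x)

theorem one_sub_ne_zero_of_norm_lt_one {z : ℂ} (hz : ‖z‖ < 1) : 1 - z ≠ 0 := by
  rintro h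
  rw [← sub_eq_zero.mp h, norm_one] at hz
  exact lt_irrefl _ hz

theorem norm_inner_lt_one_of_norm_lt_one {x y : E} (hx : ‖x‖ < 1) (hy : ‖y‖ < 1) :
    ‖⟪x, y⟫_ℂ‖ < 1 :=
  (norm_inner_le_norm x y).trans_lt (mul_lt_one_of_nonneg_of_lt_one_left (norm_nonneg _) hx hy.le)

theorem one_sub_inner_ne_zero {x y : E} (hx : ‖x‖ < 1) (hy : ‖y‖ < 1) : 1 - ⟪x, y⟫_ℂ ≠ 0 :=
  one_sub_ne_zero_of_norm_lt_one (norm_inner_lt_one_of_norm_lt_one hx hy)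

/-- With `s = √(1 - ‖a‖²)`, this is why the factor `1 / (1 + s)` in `ballInvolution` replaces `(1 -
s) / ‖a‖²` of the usual formula with the projection onto `a`; the case `a = 0` then needs no
separate treatment. -/
theorem inner_self_eq_one_sub_mul_one_add {a : E} (ha : ‖a‖ < 1) :
    ⟪a, a⟫_ℂ = (1 - (√(1 - ‖a‖ ^ 2) : ℂ)) * (1 + (√(1 - ‖a‖ ^ 2) : ℂ)) := by
  have h : √(1 - ‖a‖ ^ 2) ^ 2 = 1 - ‖a‖ ^ 2 := Real.sq_sqrt (by nlinarith [norm_nonneg a])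
  have h' : (√(1 - ‖a‖ ^ 2) : ℂ) ^ 2 = 1 - (‖a‖ : ℂ) ^ 2 := by exact_mod_cast h
  rw [inner_self_eq_norm_sq_to_K]
  simp only [Complex.coe_algebraMap]
  linear_combination h'

theorem one_add_ofReal_sqrt_ne_zero (r : ℝ) : 1 + (√r : ℂ) ≠ 0 := by
  have : (0 : ℝ) < 1 + √r := by positivity
  exact_mod_cast this.ne'

theorem ofReal_sqrt_ne_zero_of_norm_lt_one {V : Type*} [NormedAddCommGroup V] {a : V} (ha : ‖a‖ < 1) :
    (√(1 - ‖a‖ ^ 2) : ℂ) ≠ 0 := by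
  have : 0 < √(1 - ‖a‖ ^ 2) := Real.sqrt_pos.mpr (by nlinarith [norm_nonneg a])
  exact_mod_cast this.ne'

theorem ballInvolution_self (a : E) (ha : ‖a‖ < 1) : ballInvolution a a = 0 := by
  rw [ballInvolution, ← sub_smul, inner_self_eq_one_sub_mul_one_add ha,
    mul_div_cancel_right₀ _ (one_add_ofReal_sqrt_ne_zero _)]
  simp

/-- After `⟨a, a⟩ = (1 - s)(1 + s)` is inserted, this is a rational identity in `s` and three inner
products. It yields both the invariance of the ball and the rescaling of the kernel. -/
theorem one_sub_inner_ballInvolution {a x y : E} (ha : ‖a‖ < 1) (hx : ‖x‖ < 1) (hy : ‖y‖ < 1) :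
    (1 - ⟪ballInvolution a y, ballInvolution a x⟫_ℂ) * ((1 - ⟪a, x⟫_ℂ) * conj (1 - ⟪a, y⟫_ℂ)) =
      ((1 - ‖a‖ ^ 2 : ℝ) : ℂ) * (1 - ⟪y, x⟫_ℂ) := by
  have h1 := one_sub_inner_ne_zero ha hx
  have h2 := one_sub_inner_ne_zero hy ha
  have h3 := one_add_ofReal_sqrt_ne_zero (1 - ‖a‖ ^ 2)
  have h4 := inner_self_eq_one_sub_mul_one_add ha
  have h5 : ((1 - ‖a‖ ^ 2 : ℝ) : ℂ) = 1 - ⟪a, a⟫_ℂ := by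
    rw [inner_self_eq_norm_sq_to_K]; simp
  rw [h5, ballInvolution, ballInvolution]
  simp only [inner_smul_left, inner_smul_right, inner_sub_left, inner_sub_right, map_sub, map_inv₀,
    map_one, map_div₀, map_add, Complex.conj_ofReal, inner_conj_symm, h4]
  generalize (√(1 - ‖a‖ ^ 2) : ℂ) = s at *
  generalize ⟪a, x⟫_ℂ = α at *
  generalize ⟪y, a⟫_ℂ = β at *
  generalize ⟪y, x⟫_ℂ = g at *
  field_simp
  ring

theorem norm_ballInvolution_lt_one {a x : E} (ha : ‖a‖ < 1) (hx : ‖x‖ < 1) :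
    ‖ballInvolution a x‖ < 1 := by
  have h := one_sub_inner_ballInvolution ha hx hx
  have h1 := one_sub_inner_ne_zero ha hx
  rw [Complex.mul_conj, inner_self_eq_norm_sq_to_K, inner_self_eq_norm_sq_to_K] at h
  have h2 : (1 - ‖ballInvolution a x‖ ^ 2) * Complex.normSq (1 - ⟪a, x⟫_ℂ) =
      (1 - ‖a‖ ^ 2) * (1 - ‖x‖ ^ 2) := by
    simp only [Complex.coe_algebraMap] at h
    exact_mod_cast h
  have h3 : 0 < (1 - ‖a‖ ^ 2) * (1 - ‖x‖ ^ 2) := by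
    apply mul_pos <;> nlinarith [norm_nonneg a, norm_nonneg x]
  rw [← h2] at h3
  have h4 := pos_of_mul_pos_left h3 (Complex.normSq_nonneg _)
  nlinarith [norm_nonneg (ballInvolution a x)]

theorem ballInvolution_ballInvolution {a x : E} (ha : ‖a‖ < 1) (hx : ‖x‖ < 1) :
    ballInvolution a (ballInvolution a x) = x := by
  have h1 := one_sub_inner_ne_zero ha hx
  have h3 := one_add_ofReal_sqrt_ne_zero (1 - ‖a‖ ^ 2)
  have h4 := inner_self_eq_one_sub_mul_one_add ha
  have h6 := ofReal_sqrt_ne_zero_of_norm_lt_one ha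
  have h7 : ⟪a, ballInvolution a x⟫_ℂ =
      1 - (√(1 - ‖a‖ ^ 2) : ℂ) ^ 2 / (1 - ⟪a, x⟫_ℂ) := by
    rw [ballInvolution, inner_smul_right, inner_sub_right, inner_smul_right, inner_smul_right, h4]
    field_simp
    ring
  rw [ballInvolution, h7]
  nth_rewrite 1 [ballInvolution]
  generalize (√(1 - ‖a‖ ^ 2) : ℂ) = s at *
  generalize ⟪a, x⟫_ℂ = α at *
  match_scalars
  · field_simp
    ring
  · field_simp
    ring

theorem differentiableOn_ballInvolution {a : E} (ha : ‖a‖ < 1) :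
    DifferentiableOn ℂ (ballInvolution a) (Metric.ball 0 1) := by
  have h : Differentiable ℂ fun x ↦ ⟪a, x⟫_ℂ := (innerSL ℂ a).differentiable
  unfold ballInvolution
  refine .smul (.inv (by fun_prop) fun x hx ↦ ?_) (by fun_prop)
  exact one_sub_inner_ne_zero ha (mem_ball_zero_iff.mp hx)

end Moebius

/-! ### Automorphisms of the ball -/

namespace BallAut

variable {d : ℕ}

theorem isHolomorphicSelfMap_comp {Φ Ψ : UnitBall d → UnitBall d} (hΦ : IsHolomorphicSelfMap Φ)
    (hΨ : IsHolomorphicSelfMap Ψ) : IsHolomorphicSelfMap (Φ ∘ Ψ) := by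
  obtain ⟨F, hF, hFΦ⟩ := hΦ
  obtain ⟨G, hG, hGΨ⟩ := hΨ
  refine ⟨F ∘ G, hF.comp hG fun x hx ↦ ?_, fun x ↦ ?_⟩
  · exact hGΨ ⟨x, hx⟩ ▸ (Ψ ⟨x, hx⟩).2
  · rw [Function.comp_apply, hGΨ, hFΦ, Function.comp_apply]

/-- The automorphism `x ↦ Ψ (Φ x)`. -/
def trans (Φ Ψ : BallAut d) : BallAut d where
  toEquiv := Φ.toEquiv.trans Ψ.toEquiv
  holomorphic := isHolomorphicSelfMap_comp (Φ := Ψ.toFun) (Ψ := Φ.toFun) Ψ.holomorphic Φ.holomorphic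
  holomorphic_inv := isHolomorphicSelfMap_comp (Φ := Φ.invFun) (Ψ := Ψ.invFun) Φ.holomorphic_inv
    Ψ.holomorphic_inv

/-- The restriction of a unitary map to the ball. -/
def ofUnitary (U : EuclideanSpace ℂ (Fin d) ≃ₗᵢ[ℂ] EuclideanSpace ℂ (Fin d)) : BallAut d where
  toFun x := ⟨U x, by simpa using mem_ball_zero_iff.mp x.2⟩
  invFun x := ⟨U.symm x, by simpa using mem_ball_zero_iff.mp x.2⟩
  left_inv x := by simp
  right_inv x := by simp
  holomorphic := ⟨U, U.toContinuousLinearEquiv.differentiable.differentiableOn, fun _ ↦ rfl⟩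
  holomorphic_inv := ⟨U.symm, U.symm.toContinuousLinearEquiv.differentiable.differentiableOn,
    fun _ ↦ rfl⟩

/-- The involutive automorphism of the ball that exchanges `a` and `0`. -/
def involution (a : UnitBall d) : BallAut d where
  toEquiv := Function.Involutive.toPerm
    (fun x ↦ ⟨ballInvolution (a : EuclideanSpace ℂ (Fin d)) x, mem_ball_zero_iff.mpr
      (norm_ballInvolution_lt_one (mem_ball_zero_iff.mp a.2) (mem_ball_zero_iff.mp x.2))⟩)
    fun x ↦ Subtype.ext
      (ballInvolution_ballInvolution (mem_ball_zero_iff.mp a.2) (mem_ball_zero_iff.mp x.2))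
  holomorphic := ⟨_, differentiableOn_ballInvolution (mem_ball_zero_iff.mp a.2), fun _ ↦ rfl⟩
  holomorphic_inv := ⟨_, differentiableOn_ballInvolution (mem_ball_zero_iff.mp a.2), fun _ ↦ rfl⟩

theorem trans_apply (Φ Ψ : BallAut d) (x : UnitBall d) :
    (Φ.trans Ψ).toEquiv x = Ψ.toEquiv (Φ.toEquiv x) := rfl

theorem involution_involution_apply (a x : UnitBall d) :
    (involution a).toEquiv ((involution a).toEquiv x) = x :=
  (involution a).toEquiv.left_inv x

theorem coe_involution_apply_self (a : UnitBall d) :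
    ((involution a).toEquiv a : EuclideanSpace ℂ (Fin d)) = 0 :=
  ballInvolution_self _ (mem_ball_zero_iff.mp a.2)

end BallAut

/-! ### Automorphisms fixing the origin are unitary -/

section Cartan

open Metric

/-- The Schwarz lemma for `F` gives one inequality, and for its left inverse `G` the other. -/
theorem norm_apply_eq_of_mapsTo_ball_of_leftInvOn {E : Type*} [NormedAddCommGroup E]
    [NormedSpace ℂ E] {F G : E → E} (hF : DifferentiableOn ℂ F (ball 0 1))
    (hG : DifferentiableOn ℂ G (ball 0 1)) (hF1 : Set.MapsTo F (ball 0 1) (ball 0 1))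
    (hG1 : Set.MapsTo G (ball 0 1) (ball 0 1)) (hF0 : F 0 = 0)
    (hGF : Set.LeftInvOn G F (ball 0 1)) {x : E} (hx : x ∈ ball (0 : E) 1) : ‖F x‖ = ‖x‖ := by
  have hG0 : G 0 = 0 := by simpa [hF0] using hGF (mem_ball_self zero_lt_one)
  refine le_antisymm (Complex.norm_le_norm_of_mapsTo_ball hF (hF1.mono_right ball_subset_closedBall)
    hF0 (mem_ball_zero_iff.mp hx)) ?_
  have := Complex.norm_le_norm_of_mapsTo_ball hG (hG1.mono_right ball_subset_closedBall)
    hG0 (mem_ball_zero_iff.mp (hF1 hx))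
  rwa [hGF hx] at this

/-- A holomorphic map of the unit ball of a strictly convex space that preserves norms is the
restriction of its derivative at the origin. -/
theorem eq_fderiv_apply_of_norm_apply_eq {E : Type*} [NormedAddCommGroup E] [NormedSpace ℂ E]
    [StrictConvexSpace ℝ E] {F : E → E} (hF : DifferentiableOn ℂ F (ball 0 1))
    (h : ∀ x ∈ ball (0 : E) 1, ‖F x‖ = ‖x‖) {x : E} (hx : x ∈ ball (0 : E) 1) :
    F x = fderiv ℂ F 0 x := by
  have hF0 : F 0 = 0 := by simpa using h 0 (mem_ball_self zero_lt_one)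
  rcases eq_or_ne x 0 with rfl | hx0
  · simp [hF0]
  have hxn : 0 < ‖x‖ := norm_pos_iff.mpr hx0
  have hx1 : ‖x‖ < 1 := mem_ball_zero_iff.mp hx
  set u : E := ((‖x‖⁻¹ : ℝ) : ℂ) • x with hu
  have hu1 : ‖u‖ = 1 := by
    rw [hu, norm_smul, Complex.norm_real, norm_inv, norm_norm, inv_mul_cancel₀ hxn.ne']
  have hmem : ∀ z ∈ ball (0 : ℂ) 1, z • u ∈ ball (0 : E) 1 := fun z hz ↦ by
    rw [mem_ball_zero_iff, norm_smul, hu1, mul_one]; exact mem_ball_zero_iff.mp hz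
  let g : ℂ → E := fun z ↦ F (z • u)
  have hg0 : g 0 = 0 := by simp [g, hF0]
  have hgn : ∀ z ∈ ball (0 : ℂ) 1, ‖g z‖ = ‖z‖ := fun z hz ↦ by
    rw [h _ (hmem z hz), norm_smul, hu1, mul_one]
  have hg : DifferentiableOn ℂ g (ball 0 1) := hF.comp (by fun_prop) hmem
  have hz0 : (2⁻¹ : ℂ) ∈ ball (0 : ℂ) 1 := by rw [mem_ball_zero_iff]; norm_num
  -- On the complex line through `x`, equality holds in the Schwarz lemma, so `g` is linear there.
  -- The point `2⁻¹` is an arbitrary nonzero witness of equality.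
  obtain ⟨C, -, hC⟩ := Complex.affine_of_mapsTo_ball_of_exists_norm_dslope_eq_div' (R₂ := 1) hg
    (fun z hz ↦ by
      rw [hg0, mem_closedBall_zero_iff, hgn z hz]; exact (mem_ball_zero_iff.mp hz).le)
    ⟨2⁻¹, hz0, by
      rw [dslope_of_ne _ (by norm_num), slope_def_module, hg0, sub_zero, sub_zero, norm_smul,
        hgn _ hz0]
      norm_num⟩
  have hC' : ∀ z ∈ ball (0 : ℂ) 1, g z = z • C := fun z hz ↦ by simpa [hg0] using hC hz
  have hd1 : HasDerivAt g C 0 := by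
    have : HasDerivAt (fun z : ℂ ↦ z • C) C 0 := by
      simpa using (hasDerivAt_id (0 : ℂ)).smul_const C
    refine this.congr_of_eventuallyEq ?_
    filter_upwards [ball_mem_nhds (0 : ℂ) zero_lt_one] with z hz using hC' z hz
  have hd2 : HasDerivAt g (fderiv ℂ F 0 u) 0 := by
    have hFd : HasFDerivAt F (fderiv ℂ F 0) ((0 : ℂ) • u) := by
      rw [zero_smul]
      exact (hF.differentiableAt (ball_mem_nhds 0 zero_lt_one)).hasFDerivAt
    have : HasDerivAt (fun z : ℂ ↦ z • u) u 0 := by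
      simpa using (hasDerivAt_id (0 : ℂ)).smul_const u
    exact hFd.comp_hasDerivAt 0 this
  have hxu : x = (‖x‖ : ℂ) • u := by
    rw [hu, smul_smul, ← Complex.ofReal_mul, mul_inv_cancel₀ hxn.ne', Complex.ofReal_one, one_smul]
  have hz : (‖x‖ : ℂ) ∈ ball (0 : ℂ) 1 := by simpa using hx1
  calc F x = g (‖x‖ : ℂ) := by rw [← show F ((‖x‖ : ℂ) • u) = g (‖x‖ : ℂ) from rfl, ← hxu]
    _ = (‖x‖ : ℂ) • fderiv ℂ F 0 u := by rw [hC' _ hz, hd1.unique hd2]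
    _ = fderiv ℂ F 0 x := by rw [← map_smul, ← hxu]

theorem BallAut.exists_linearIsometry_of_fixes_zero {d : ℕ} (Φ : BallAut d)
    (h0 : ∀ x : UnitBall d, (x : EuclideanSpace ℂ (Fin d)) = 0 →
      (Φ.toEquiv x : EuclideanSpace ℂ (Fin d)) = 0) :
    ∃ U : EuclideanSpace ℂ (Fin d) →ₗᵢ[ℂ] EuclideanSpace ℂ (Fin d),
      ∀ x : UnitBall d, (Φ.toEquiv x : EuclideanSpace ℂ (Fin d)) = U x := by
  obtain ⟨F, hF, hFΦ⟩ := Φ.holomorphic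
  obtain ⟨G, hG, hGΦ⟩ := Φ.holomorphic_inv
  have hn : ∀ x ∈ ball (0 : EuclideanSpace ℂ (Fin d)) 1, ‖F x‖ = ‖x‖ := fun x hx ↦
    norm_apply_eq_of_mapsTo_ball_of_leftInvOn hF hG
      (fun x hx ↦ hFΦ ⟨x, hx⟩ ▸ (Φ.toFun ⟨x, hx⟩).2)
      (fun x hx ↦ hGΦ ⟨x, hx⟩ ▸ (Φ.invFun ⟨x, hx⟩).2)
      ((hFΦ ⟨0, mem_ball_self zero_lt_one⟩).trans (h0 _ rfl))
      (fun x hx ↦ by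
        have e := hFΦ ⟨x, hx⟩
        have e' := hGΦ (Φ.toFun ⟨x, hx⟩)
        rw [Φ.left_inv, ← e] at e'
        exact e') hx
  have hlin : ∀ x ∈ ball (0 : EuclideanSpace ℂ (Fin d)) 1, F x = fderiv ℂ F 0 x := fun x hx ↦
    eq_fderiv_apply_of_norm_apply_eq hF hn hx
  refine ⟨⟨(fderiv ℂ F 0).toLinearMap, fun x ↦ ?_⟩, fun x ↦ ?_⟩
  -- Norm preservation is known on the ball only; `x` is scaled into it.
  · have hpos : 0 < (‖x‖ + 1)⁻¹ := by positivity
    have hmem : (((‖x‖ + 1)⁻¹ : ℝ) : ℂ) • x ∈ ball (0 : EuclideanSpace ℂ (Fin d)) 1 := by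
      rw [mem_ball_zero_iff, norm_smul, Complex.norm_real, Real.norm_of_nonneg hpos.le,
        inv_mul_lt_one₀ (by positivity)]
      linarith
    have := hn _ hmem
    rw [hlin _ hmem, map_smul, norm_smul, norm_smul] at this
    exact mul_left_cancel₀ (by rw [Complex.norm_real]; exact (norm_pos_iff.mpr hpos.ne').ne') this
  · exact (hFΦ x).symm.trans (hlin x x.2)

end Cartan

/-! ### Transformation of the kernel under automorphisms -/

section PowerIdentities

theorem re_one_sub_pos_of_norm_lt_one {z : ℂ} (hz : ‖z‖ < 1) : 0 < (1 - z).re := by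
  have := (Complex.re_le_norm z).trans_lt hz
  simpa using this

/-- On a connected space, `u v w = c z` implies the same identity between the principal powers, if
it holds for the principal logarithms at one point. -/
theorem cpow_mul_cpow_mul_cpow_eq {X : Type*} [TopologicalSpace X] [PreconnectedSpace X]
    {u v w z : X → ℂ} {c : ℂ} (hu : Continuous u) (hv : Continuous v) (hw : Continuous w)
    (hz : Continuous z) (hu' : ∀ x, u x ∈ Complex.slitPlane) (hv' : ∀ x, v x ∈ Complex.slitPlane)
    (hw' : ∀ x, w x ∈ Complex.slitPlane) (hz' : ∀ x, z x ∈ Complex.slitPlane) (hc : c ≠ 0)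
    (h : ∀ x, u x * (v x * w x) = c * z x) (x₀ : X)
    (h₀ : (u x₀).log + ((v x₀).log + (w x₀).log) = c.log + (z x₀).log) (t : ℂ) (x : X) :
    u x ^ t * (v x ^ t * w x ^ t) = c ^ t * z x ^ t := by
  have hu0 := fun x ↦ Complex.slitPlane_ne_zero (hu' x)
  have hv0 := fun x ↦ Complex.slitPlane_ne_zero (hv' x)
  have hw0 := fun x ↦ Complex.slitPlane_ne_zero (hw' x)
  have hz0 := fun x ↦ Complex.slitPlane_ne_zero (hz' x)
  -- The two sums of logarithms differ by `2πi n(x)`; `n` is continuous and integer valued, hence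
  -- constant, and it vanishes at `x₀`.
  have hex : ∀ x, ∃ n : ℤ, (u x).log + ((v x).log + (w x).log) =
      c.log + (z x).log + n * (2 * Real.pi * Complex.I) := fun x ↦ by
    rw [← Complex.exp_eq_exp_iff_exists_int]
    simp only [Complex.exp_add, Complex.exp_log, hu0, hv0, hw0, hz0, hc, ne_eq, not_false_eq_true,
      h]
  choose n hn using hex
  have hcont : Continuous n := by
    rw [Int.isClosedEmbedding_coe_real.isEmbedding.continuous_iff]
    have : (fun k : ℤ ↦ (k : ℝ)) ∘ n = fun x ↦
        (((u x).log + ((v x).log + (w x).log)) - (c.log + (z x).log)).im / (2 * Real.pi) := by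
      funext x
      rw [hn x, add_sub_cancel_left]
      simp [Real.pi_ne_zero]
    rw [this]
    exact (Complex.continuous_im.comp (((hu.clog hu').add ((hv.clog hv').add (hw.clog hw'))).sub
      (continuous_const.add (hz.clog hz')))).div_const _
  have hn0 : n x₀ = 0 := by
    have := hn x₀
    rw [h₀, left_eq_add] at this
    simpa [Real.pi_ne_zero] using this
  have hx := hn x
  rw [PreconnectedSpace.constant inferInstance hcont (y := x₀), hn0, Int.cast_zero, zero_mul,
    add_zero] at hx
  rw [Complex.cpow_def_of_ne_zero (hu0 x), Complex.cpow_def_of_ne_zero (hv0 x),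
    Complex.cpow_def_of_ne_zero (hw0 x), Complex.cpow_def_of_ne_zero (hz0 x),
    Complex.cpow_def_of_ne_zero hc, ← Complex.exp_add, ← Complex.exp_add, ← Complex.exp_add,
    ← add_mul, ← add_mul, hx, add_mul]

/-- The power `z ↦ z ^ t` is injective on the right half plane if `0 < t ≤ 2`. -/
theorem eq_of_cpow_eq_of_re_pos {t : ℝ} (ht : 0 < t) (ht2 : t ≤ 2) {z w : ℂ} (hz : 0 < z.re)
    (hw : 0 < w.re) (h : z ^ (t : ℂ) = w ^ (t : ℂ)) : z = w := by
  have hne : ∀ {z : ℂ}, 0 < z.re → z ≠ 0 := by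
    rintro z hz rfl
    simp at hz
  -- Here `t ≤ 2` enters: `|arg z| < π/2` keeps `t log z` in the strip where `exp` is injective.
  have him : ∀ {z : ℂ}, 0 < z.re → |(z.log * t).im| < Real.pi := by
    intro z hz
    have h1 := Complex.abs_arg_lt_pi_div_two_iff.mpr (Or.inl hz)
    rw [Complex.im_mul_ofReal, Complex.log_im, abs_mul, abs_of_pos ht]
    nlinarith [abs_nonneg z.arg]
  rw [Complex.cpow_def_of_ne_zero (hne hz), Complex.cpow_def_of_ne_zero (hne hw)] at h
  have hz1 := abs_lt.mp (him hz)
  have hw1 := abs_lt.mp (him hw)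
  have h2 := Complex.exp_inj_of_neg_pi_lt_of_le_pi hz1.1 hz1.2.le hw1.1 hw1.2.le h
  have h3 := mul_right_cancel₀ (Complex.ofReal_ne_zero.mpr ht.ne') h2
  rw [← Complex.exp_log (hne hz), h3, Complex.exp_log (hne hw)]

end PowerIdentities

/-! ### Rescalings of the kernel and automorphisms -/

section Rescaling

variable {d : ℕ} {t : ℝ}

theorem re_one_sub_inner_unitBall_pos (x y : UnitBall d) :
    0 < (1 - ⟪(y : EuclideanSpace ℂ (Fin d)), (x : EuclideanSpace ℂ (Fin d))⟫_ℂ).re :=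
  re_one_sub_pos_of_norm_lt_one (norm_inner_unitBall_lt x y)

theorem ballKernel_ne_zero (x y : UnitBall d) : ballKernel d t x y ≠ 0 := by
  refine one_div_ne_zero fun h ↦ ?_
  have := re_one_sub_inner_unitBall_pos x y
  rw [((Complex.cpow_eq_zero_iff _ _).mp h).1] at this
  simp at this

/-- `Φ` transforms the kernel into itself, up to a nonvanishing rescaling. -/
def RescalesKernel (t : ℝ) (Φ : UnitBall d → UnitBall d) : Prop :=
  ∃ f : UnitBall d → ℂ, (∀ x, f x ≠ 0) ∧
    ∀ x y, ballKernel d t x y = conj (f x) * f y * ballKernel d t (Φ x) (Φ y)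

theorem RescalesKernel.comp {Φ Ψ : UnitBall d → UnitBall d} (hΦ : RescalesKernel t Φ)
    (hΨ : RescalesKernel t Ψ) : RescalesKernel t (Φ ∘ Ψ) := by
  obtain ⟨f, hf, hfΦ⟩ := hΦ
  obtain ⟨g, hg, hgΨ⟩ := hΨ
  refine ⟨fun x ↦ g x * f (Ψ x), fun x ↦ mul_ne_zero (hg x) (hf _), fun x y ↦ ?_⟩
  rw [hgΨ, hfΦ, map_mul, Function.comp_apply, Function.comp_apply]
  ring

theorem rescalesKernel_of_inner_eq {Φ : UnitBall d → UnitBall d}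
    (h : ∀ x y, ⟪(Φ y : EuclideanSpace ℂ (Fin d)), (Φ x : EuclideanSpace ℂ (Fin d))⟫_ℂ =
      ⟪(y : EuclideanSpace ℂ (Fin d)), (x : EuclideanSpace ℂ (Fin d))⟫_ℂ) :
    RescalesKernel t Φ :=
  ⟨fun _ ↦ 1, fun _ ↦ one_ne_zero, fun x y ↦ by simp [ballKernel, h]⟩

instance instPreconnectedSpaceUnitBall : PreconnectedSpace (UnitBall d) :=
  Subtype.preconnectedSpace (convex_ball _ _).isPreconnected

theorem BallAut.continuous_toEquiv (Φ : BallAut d) : Continuous Φ.toEquiv := by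
  obtain ⟨F, hF, hFΦ⟩ := Φ.holomorphic
  rw [continuous_induced_rng]
  exact (continuousOn_iff_continuous_domRestrict.mp hF.continuousOn).congr hFΦ

theorem BallAut.rescalesKernel_involution (a : UnitBall d) :
    RescalesKernel t (BallAut.involution a).toEquiv := by
  have ha : ‖(a : EuclideanSpace ℂ (Fin d))‖ < 1 := mem_ball_zero_iff.mp a.2
  have hΦ := (BallAut.involution a).continuous_toEquiv
  set Φ := (BallAut.involution a).toEquiv with hΦdef
  let p : UnitBall d → ℂ := fun x ↦
    1 - ⟪(a : EuclideanSpace ℂ (Fin d)), (x : EuclideanSpace ℂ (Fin d))⟫_ℂ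
  have hp : ∀ x, 0 < (p x).re := fun x ↦ re_one_sub_inner_unitBall_pos x a
  set c : ℝ := 1 - ‖(a : EuclideanSpace ℂ (Fin d))‖ ^ 2
  have hc : 0 < c := by
    simp only [c]
    nlinarith [norm_nonneg (a : EuclideanSpace ℂ (Fin d))]
  have hid : ∀ x y : UnitBall d,
      (1 - ⟪(Φ y : EuclideanSpace ℂ (Fin d)), (Φ x : EuclideanSpace ℂ (Fin d))⟫_ℂ) *
        (p x * conj (p y)) =
      (c : ℂ) * (1 - ⟪(y : EuclideanSpace ℂ (Fin d)), (x : EuclideanSpace ℂ (Fin d))⟫_ℂ) :=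
    fun x y ↦ one_sub_inner_ballInvolution ha (mem_ball_zero_iff.mp x.2) (mem_ball_zero_iff.mp y.2)
  let o : UnitBall d := ⟨0, Metric.mem_ball_self zero_lt_one⟩
  have hpo : p o = 1 := by simp [p, o]
  have hpow := fun x y : UnitBall d ↦ cpow_mul_cpow_mul_cpow_eq
    (u := fun q : UnitBall d × UnitBall d ↦
      1 - ⟪(Φ q.2 : EuclideanSpace ℂ (Fin d)), (Φ q.1 : EuclideanSpace ℂ (Fin d))⟫_ℂ)
    (v := fun q ↦ p q.1) (w := fun q ↦ conj (p q.2))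
    (z := fun q ↦ 1 - ⟪(q.2 : EuclideanSpace ℂ (Fin d)), (q.1 : EuclideanSpace ℂ (Fin d))⟫_ℂ)
    (c := c) (by fun_prop) (by fun_prop)
    (Complex.continuous_conj.comp (by fun_prop)) (by fun_prop)
    (fun q ↦ Or.inl (re_one_sub_inner_unitBall_pos _ _)) (fun q ↦ Or.inl (hp _))
    (fun q ↦ Or.inl (by rw [Complex.conj_re]; exact hp _))
    (fun q ↦ Or.inl (re_one_sub_inner_unitBall_pos _ _)) (Complex.ofReal_ne_zero.mpr hc.ne')
    (fun q ↦ hid q.1 q.2) (o, o) (by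
      have := hid o o
      simp only [hpo, map_one, mul_one] at this
      simp only [this, hpo, map_one, Complex.log_one, add_zero]
      simp [o]) (t : ℂ) (x, y)
  have hp0 : ∀ x, p x ^ (t : ℂ) ≠ 0 := fun x h ↦ by
    have := hp x
    rw [((Complex.cpow_eq_zero_iff _ _).mp h).1] at this
    simp at this
  -- The constant `c ^ t` is split evenly, so that the factor takes the form `conj (f x) * f y`.
  set r : ℝ := c ^ (t / 2)
  have hr : (c : ℂ) ^ (t : ℂ) = (r : ℂ) * r := by
    rw [← Complex.ofReal_cpow hc.le, ← Complex.ofReal_mul, ← Real.rpow_add hc, add_halves]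
  have hr0 : (r : ℂ) ≠ 0 := Complex.ofReal_ne_zero.mpr (Real.rpow_pos_of_pos hc _).ne'
  have hconj : ∀ y, conj (p y) ^ (t : ℂ) = conj (p y ^ (t : ℂ)) := fun y ↦ by
    rw [Complex.conj_cpow _ _ (Complex.mem_slitPlane_iff_arg.mp (Or.inl (hp y))).1,
      Complex.conj_ofReal]
  refine ⟨fun x ↦ r / conj (p x ^ (t : ℂ)),
    fun x ↦ div_ne_zero hr0 ((map_ne_zero _).mpr (hp0 x)), fun x y ↦ ?_⟩
  have h := hpow x y
  simp only [hconj, hr] at h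
  have hx := hp0 x
  have hy := (map_ne_zero (starRingEnd ℂ)).mpr (hp0 y)
  have h1 := one_div_ne_zero (ballKernel_ne_zero (t := t) x y)
  have h2 := one_div_ne_zero (ballKernel_ne_zero (t := t) (Φ x) (Φ y))
  simp only [ballKernel, one_div_one_div] at h1 h2 ⊢
  rw [map_div₀, Complex.conj_ofReal, Complex.conj_conj]
  field_simp
  linear_combination h

/-- Following `Φ` by the involution at `Φ 0` gives an automorphism fixing `0`, hence a linear
isometry. -/
theorem BallAut.exists_eq_involution_comp (Φ : BallAut d) :
    ∃ (a : UnitBall d) (U : EuclideanSpace ℂ (Fin d) →ₗᵢ[ℂ] EuclideanSpace ℂ (Fin d))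
      (Ψ : UnitBall d → UnitBall d), (∀ x, (Ψ x : EuclideanSpace ℂ (Fin d)) = U x) ∧
      ⇑Φ.toEquiv = (BallAut.involution a).toEquiv ∘ Ψ := by
  let o : UnitBall d := ⟨0, Metric.mem_ball_self zero_lt_one⟩
  obtain ⟨U, hU⟩ := (Φ.trans (involution (Φ.toEquiv o))).exists_linearIsometry_of_fixes_zero
    fun x hx ↦ by
      rw [show x = o from Subtype.ext hx, trans_apply, coe_involution_apply_self]
  refine ⟨Φ.toEquiv o, U, _, hU, funext fun x ↦ ?_⟩
  rw [Function.comp_apply, trans_apply, involution_involution_apply]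

theorem BallAut.rescalesKernel (Φ : BallAut d) : RescalesKernel t Φ.toEquiv := by
  obtain ⟨a, U, Ψ, hΨ, hΦ⟩ := Φ.exists_eq_involution_comp
  rw [hΦ]
  refine (rescalesKernel_involution a).comp (rescalesKernel_of_inner_eq fun x y ↦ ?_)
  rw [hΨ, hΨ, U.inner_map_map]

/-- For `t ≤ 2`, a map that rescales the kernel is the restriction of an automorphism. -/
theorem exists_ballAut_of_rescaling (ht : 0 < t) (ht2 : t ≤ 2) {A : Set (UnitBall d)}
    {φ : A → UnitBall d} {f : A → ℂ}
    (h : ∀ x y : A, ballKernel d t x y = conj (f x) * f y * ballKernel d t (φ x) (φ y)) :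
    ∃ Φ : BallAut d, ∀ a : A, Φ.toEquiv a = φ a := by
  rcases isEmpty_or_nonempty A with hA | ⟨⟨a₀⟩⟩
  · exact ⟨.ofUnitary (.refl _ _), fun a ↦ hA.elim a⟩
  set Φ := BallAut.involution (a₀ : UnitBall d)
  set Ψ := BallAut.involution (φ a₀)
  obtain ⟨g, hg, hgΦ⟩ := Φ.rescalesKernel (t := t)
  obtain ⟨k, -, hkΨ⟩ := Ψ.rescalesKernel (t := t)
  have hone : ∀ x y : UnitBall d, (y : EuclideanSpace ℂ (Fin d)) = 0 → ballKernel d t x y = 1 :=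
    fun x y hy ↦ by simp [ballKernel, hy]
  have hΦ0 : (Φ.toEquiv a₀ : EuclideanSpace ℂ (Fin d)) = 0 := BallAut.coe_involution_apply_self _
  have hΨ0 : (Ψ.toEquiv (φ a₀) : EuclideanSpace ℂ (Fin d)) = 0 :=
    BallAut.coe_involution_apply_self _
  let m : A → ℂ := fun x ↦ f x * k (φ x) / g x
  have hm : ∀ x y : A, ballKernel d t (Φ.toEquiv x) (Φ.toEquiv y) =
      conj (m x) * m y * ballKernel d t (Ψ.toEquiv (φ x)) (Ψ.toEquiv (φ y)) := fun x y ↦ by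
    have h1 := hg x
    have h2 := hg y
    have h3 := (map_ne_zero (starRingEnd ℂ)).mpr h1
    have h4 := h x y
    rw [hkΨ (φ x), hgΦ x] at h4
    simp only [m, map_div₀, map_mul]
    field_simp
    linear_combination h4
  -- Both base points now sit at the origin, where both kernels equal `1`.
  have hm1 : ∀ x, conj (m x) * m a₀ = 1 := fun x ↦ by
    have := hm x a₀
    rwa [hone _ _ hΦ0, hone _ _ hΨ0, mul_one, eq_comm] at this
  -- Thus `m` is a unimodular constant and drops out of `hm`.
  have hm2 : ∀ x y, conj (m x) * m y = 1 := fun x y ↦ by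
    have h1 := hm1 x
    have h2 := congrArg conj (hm1 y)
    have h3 := hm1 a₀
    rw [map_mul, map_one, Complex.conj_conj] at h2
    linear_combination (conj (m a₀) * m y) * h1 + h2 - conj (m x) * m y * h3
  have hinner : ∀ x y : A, ⟪(Φ.toEquiv x : EuclideanSpace ℂ (Fin d)),
      (Φ.toEquiv y : EuclideanSpace ℂ (Fin d))⟫_ℂ =
      ⟪(Ψ.toEquiv (φ x) : EuclideanSpace ℂ (Fin d)),
        (Ψ.toEquiv (φ y) : EuclideanSpace ℂ (Fin d))⟫_ℂ := fun x y ↦ by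
    have := hm y x
    rw [hm2, one_mul, ballKernel, ballKernel, one_div, one_div, inv_inj] at this
    exact sub_right_injective (eq_of_cpow_eq_of_re_pos ht ht2
      (re_one_sub_inner_unitBall_pos _ _) (re_one_sub_inner_unitBall_pos _ _) this)
  obtain ⟨U, hU⟩ := exists_linearIsometryEquiv_extension_of_gram_eq hinner
  refine ⟨(Φ.trans (.ofUnitary U)).trans Ψ, fun a ↦ ?_⟩
  rw [BallAut.trans_apply, BallAut.trans_apply]
  have : (BallAut.ofUnitary U).toEquiv (Φ.toEquiv a) = Ψ.toEquiv (φ a) := Subtype.ext (hU a)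
  rw [this, BallAut.involution_involution_apply]

theorem isometricHFS_of_ballCongruent [Fact (0 < t)] {A B : Set (UnitBall d)}
    (h : BallCongruent A B) :
    IsometricHFS (kernelSubspace (BallSpace d t) A) (kernelSubspace (BallSpace d t) B) := by
  obtain ⟨Φ, rfl⟩ := h
  obtain ⟨f, hf, hfΦ⟩ := Φ.rescalesKernel (t := t)
  have hb := (Φ.toEquiv.injective.injOn (s := A)).bijOn_image.bijective
  exact ⟨_, hb, inducesIsometricIso_ballSpace_of_rescaling hb.2 (f := fun x ↦ f x)
    (fun x ↦ hf x) fun x y ↦ hfΦ x y⟩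

theorem isFaithful_of_le_two [ht : Fact (0 < t)] (ht2 : t ≤ 2) : IsFaithful d t := by
  intro A B φ h
  obtain ⟨f, hf⟩ := exists_rescaling_of_inducesIsometricIso_ballSpace h
  exact exists_ballAut_of_rescaling (φ := fun a ↦ (φ a : UnitBall d)) ht.out ht2 hf

theorem IsFaithful.ballCongruent [Fact (0 < t)] (h : IsFaithful d t) {A B : Set (UnitBall d)}
    (hAB : IsometricHFS (kernelSubspace (BallSpace d t) A) (kernelSubspace (BallSpace d t) B)) :
    BallCongruent A B := by
  obtain ⟨φ, hφ, hiso⟩ := hAB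
  obtain ⟨Φ, hΦ⟩ := h A B φ hiso
  refine ⟨Φ, Set.Subset.antisymm ?_ fun b hb ↦ ?_⟩
  · rintro _ ⟨a, ha, rfl⟩
    rw [hΦ ⟨a, ha⟩]
    exact (φ _).2
  · obtain ⟨a, ha⟩ := hφ.2 ⟨b, hb⟩
    exact ⟨a, a.2, by rw [hΦ, ha]⟩

end Rescaling

/-! ### A triangle that is not congruent to its mirror image -/

section MirrorImage

variable {d : ℕ}

/-- The pseudohyperbolic invariant `(1 - |x|²)(1 - |y|²) / |1 - ⟨x, y⟩|²` of a pair of points. -/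
def ballInvariant (x y : UnitBall d) : ℝ :=
  (1 - ‖(x : EuclideanSpace ℂ (Fin d))‖ ^ 2) * (1 - ‖(y : EuclideanSpace ℂ (Fin d))‖ ^ 2) /
    ‖1 - ⟪(y : EuclideanSpace ℂ (Fin d)), (x : EuclideanSpace ℂ (Fin d))⟫_ℂ‖ ^ 2

theorem ballInvariant_comm (x y : UnitBall d) : ballInvariant x y = ballInvariant y x := by
  rw [ballInvariant, ballInvariant,
    mul_comm (1 - ‖(x : EuclideanSpace ℂ (Fin d))‖ ^ 2), ← Complex.norm_conj, map_sub, map_one,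
    inner_conj_symm]

/-- In this form the factors of a rescaling cancel, which makes the quantity invariant under
automorphisms. -/
theorem ballInvariant_eq_div_norm_ballKernel (x y : UnitBall d) :
    ballInvariant x y =
      ‖ballKernel d 1 x y‖ ^ 2 / (‖ballKernel d 1 x x‖ * ‖ballKernel d 1 y y‖) := by
  have hs : ∀ x : UnitBall d, ‖ballKernel d 1 x x‖ =
      (1 - ‖(x : EuclideanSpace ℂ (Fin d))‖ ^ 2)⁻¹ := fun x ↦ by
    have hx : ‖(x : EuclideanSpace ℂ (Fin d))‖ < 1 := mem_ball_zero_iff.mp x.2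
    rw [ballKernel, Complex.ofReal_one, Complex.cpow_one, inner_self_eq_norm_sq_to_K,
      one_div, norm_inv]
    have : (1 - (‖(x : EuclideanSpace ℂ (Fin d))‖ : ℂ) ^ 2) =
        ((1 - ‖(x : EuclideanSpace ℂ (Fin d))‖ ^ 2 : ℝ) : ℂ) := by push_cast; rfl
    erw [this]
    rw [ Complex.norm_real, Real.norm_of_nonneg]
    nlinarith [norm_nonneg (x : EuclideanSpace ℂ (Fin d))]
  rw [hs, hs, ballKernel, Complex.ofReal_one, Complex.cpow_one, ballInvariant, one_div, norm_inv,
    ← mul_inv, div_inv_eq_mul, inv_pow, div_eq_mul_inv, mul_comm]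

theorem BallAut.ballInvariant_apply (Φ : BallAut d) (x y : UnitBall d) :
    ballInvariant (Φ.toEquiv x) (Φ.toEquiv y) = ballInvariant x y := by
  obtain ⟨f, hf, h⟩ := Φ.rescalesKernel (t := 1)
  rw [ballInvariant_eq_div_norm_ballKernel, ballInvariant_eq_div_norm_ballKernel, h x y, h x x,
    h y y]
  have hx := norm_ne_zero_iff.mpr (hf x)
  have hy := norm_ne_zero_iff.mpr (hf y)
  have h1 := norm_ne_zero_iff.mpr (ballKernel_ne_zero (t := 1) (Φ.toEquiv x) (Φ.toEquiv x))
  have h2 := norm_ne_zero_iff.mpr (ballKernel_ne_zero (t := 1) (Φ.toEquiv y) (Φ.toEquiv y))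
  simp only [norm_mul, Complex.norm_conj]
  field_simp

theorem ballInvariant_self (x : UnitBall d) : ballInvariant x x = 1 := by
  rw [ballInvariant_eq_div_norm_ballKernel, sq, div_self]
  have := norm_ne_zero_iff.mpr (ballKernel_ne_zero (t := 1) x x)
  exact mul_ne_zero this this

/-- Complex conjugation of the coordinates of a vector. -/
def conjVector (x : EuclideanSpace ℂ (Fin d)) : EuclideanSpace ℂ (Fin d) :=
  WithLp.toLp 2 fun i ↦ conj (x i)

theorem inner_conjVector (x y : EuclideanSpace ℂ (Fin d)) :
    ⟪conjVector x, conjVector y⟫_ℂ = conj ⟪x, y⟫_ℂ := by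
  simp [conjVector, PiLp.inner_apply, mul_comm]

theorem norm_conjVector (x : EuclideanSpace ℂ (Fin d)) : ‖conjVector x‖ = ‖x‖ := by
  simp [conjVector, EuclideanSpace.norm_eq]

/-- Complex conjugation as a map of the ball. -/
def mirror (x : UnitBall d) : UnitBall d :=
  ⟨conjVector x, by simpa [norm_conjVector] using mem_ball_zero_iff.mp x.2⟩

theorem mirror_mirror (x : UnitBall d) : mirror (mirror x) = x := by
  refine Subtype.ext ?_
  ext i
  simp [mirror, conjVector]

theorem ballInvariant_mirror (x y : UnitBall d) :
    ballInvariant (mirror x) (mirror y) = ballInvariant x y := by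
  rw [ballInvariant, ballInvariant]
  simp only [mirror, norm_conjVector, inner_conjVector]
  rw [← Complex.norm_conj, map_sub, map_one, Complex.conj_conj]

theorem ballKernel_mirror (t : ℝ) (x y : UnitBall d) :
    ballKernel d t (mirror x) (mirror y) = ballKernel d t y x := by
  simp only [ballKernel, mirror, inner_conjVector, inner_conj_symm]

/-- The kernel subspaces of a set and of its mirror image are isometric if the kernel is real on
the set. -/
theorem isometricHFS_mirror {t : ℝ} [Fact (0 < t)] {A : Set (UnitBall d)}
    (h : ∀ x ∈ A, ∀ y ∈ A, ballKernel d t x y = ballKernel d t y x) :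
    IsometricHFS (kernelSubspace (BallSpace d t) A)
      (kernelSubspace (BallSpace d t) (mirror '' A)) := by
  let φ : A → mirror '' A := fun x ↦ ⟨mirror x, x, x.2, rfl⟩
  have hφ : Function.Bijective φ := by
    refine ⟨fun x y hxy ↦ Subtype.ext ?_, ?_⟩
    · rw [← mirror_mirror (x : UnitBall d), ← mirror_mirror (y : UnitBall d)]
      exact congrArg mirror (Subtype.ext_iff.mp hxy)
    · rintro ⟨_, x, hx, rfl⟩
      exact ⟨⟨x, hx⟩, rfl⟩
  have hφ' : ∀ x : A, (φ x : UnitBall d) = mirror x := fun _ ↦ rfl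
  refine ⟨φ, hφ, inducesIsometricIso_ballSpace_of_rescaling hφ.2 (f := fun _ ↦ 1)
    (fun _ ↦ one_ne_zero) fun x y ↦ ?_⟩
  rw [map_one, one_mul, one_mul, hφ', hφ', ballKernel_mirror, h x x.2 y y.2]

/-- A map of a scalene triangle into itself that preserves side lengths fixes the vertices. -/
theorem eq_of_scalene {X : Type*} {δ : X → X → ℝ} (hδ : ∀ x y, δ x y = δ y x)
    (hδ1 : ∀ x, δ x x = 1) {p q r : X} (hpq : δ p q ≠ 1) (hpr : δ p r ≠ 1) (hqr : δ q r ≠ 1)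
    (h1 : δ p q ≠ δ p r) (h2 : δ p q ≠ δ q r) (h3 : δ p r ≠ δ q r) {g : X → X}
    (hg : ∀ x y, δ (g x) (g y) = δ x y)
    (hgA : ∀ x ∈ ({p, q, r} : Set X), g x ∈ ({p, q, r} : Set X)) :
    g p = p ∧ g q = q ∧ g r = r := by
  have e1 := hg p q
  have e2 := hg p r
  have e3 := hg q r
  have hqp := hδ q p
  have hrp := hδ r p
  have hrq := hδ r q
  have gp : g p = p ∨ g p = q ∨ g p = r := hgA p (by simp)
  have gq : g q = p ∨ g q = q ∨ g q = r := hgA q (by simp)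
  have gr : g r = p ∨ g r = q ∨ g r = r := hgA r (by simp)
  -- Of the 27 assignments, those merging two vertices give a side the value `1`, and a nontrivial
  -- permutation identifies two different sides.
  rcases gp with gp | gp | gp <;> rcases gq with gq | gq | gq <;> rcases gr with gr | gr | gr <;>
    rw [gp, gq] at e1 <;> rw [gp, gr] at e2 <;> rw [gq, gr] at e3 <;> grind

/-- A scalene triangle with a vertex at the origin is not congruent to its mirror image, unless the
inner product of the other two vertices is real. -/
theorem not_ballCongruent_mirror {o a b : UnitBall d} (ho : (o : EuclideanSpace ℂ (Fin d)) = 0)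
    (hoa : ballInvariant o a ≠ 1) (hob : ballInvariant o b ≠ 1) (hab : ballInvariant a b ≠ 1)
    (h1 : ballInvariant o a ≠ ballInvariant o b) (h2 : ballInvariant o a ≠ ballInvariant a b)
    (h3 : ballInvariant o b ≠ ballInvariant a b)
    (him : conj ⟪(a : EuclideanSpace ℂ (Fin d)), (b : EuclideanSpace ℂ (Fin d))⟫_ℂ ≠
      ⟪(a : EuclideanSpace ℂ (Fin d)), (b : EuclideanSpace ℂ (Fin d))⟫_ℂ) :
    ¬ BallCongruent {o, a, b} (mirror '' {o, a, b}) := by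
  rintro ⟨Φ, hΦ⟩
  -- `mirror ∘ Φ` preserves the triangle and its sides, so `Φ` agrees with `mirror` at the vertices.
  -- In particular `Φ` fixes `0`, so it is a linear isometry, while `mirror` conjugates `⟨a, b⟩`.
  obtain ⟨eo, ea, eb⟩ := eq_of_scalene ballInvariant_comm ballInvariant_self hoa hob hab h1 h2 h3
    (g := fun x ↦ mirror (Φ.toEquiv x))
    (fun x y ↦ by rw [ballInvariant_mirror, Φ.ballInvariant_apply]) fun x hx ↦ by
      obtain ⟨y, hy, hxy⟩ := hΦ ▸ Set.mem_image_of_mem Φ.toEquiv hx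
      simpa only [← hxy, mirror_mirror] using hy
  have key : ∀ {x : UnitBall d}, mirror (Φ.toEquiv x) = x → Φ.toEquiv x = mirror x := fun h ↦ by
    conv_rhs => rw [← h]
    rw [mirror_mirror]
  obtain ⟨U, hU⟩ := Φ.exists_linearIsometry_of_fixes_zero fun x hx ↦ by
    rw [show x = o from Subtype.ext (hx.trans ho.symm), key eo]
    exact norm_eq_zero.mp ((norm_conjVector _).trans (by rw [ho, norm_zero]))
  refine him ?_
  rw [← inner_conjVector, ← U.inner_map_map (a : EuclideanSpace ℂ (Fin d)), ← hU, ← hU, key ea,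
    key eb]
  rfl

/-- The principal arguments are `±π/t`, and multiplication by `t` turns them into `±π`, where `exp`
gives `-1` for both signs. -/
theorem cos_mul_exp_cpow_pi_div {t : ℝ} (ht : 2 < t) :
    ((Real.cos (Real.pi / t) : ℂ) * Complex.exp ((Real.pi / t : ℝ) * Complex.I)) ^ (t : ℂ) =
      -(Real.cos (Real.pi / t) : ℂ) ^ (t : ℂ) ∧
    ((Real.cos (Real.pi / t) : ℂ) * Complex.exp (-(Real.pi / t : ℝ) * Complex.I)) ^ (t : ℂ) =
      -(Real.cos (Real.pi / t) : ℂ) ^ (t : ℂ) := by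
  have hθ : 0 < Real.pi / t := by positivity
  have hθ2 : Real.pi / t < Real.pi / 2 := by gcongr
  have hc : 0 < Real.cos (Real.pi / t) := Real.cos_pos_of_mem_Ioo ⟨by linarith, hθ2⟩
  have hpi := Real.pi_pos
  have hmul : (Real.pi / t : ℝ) * (t : ℂ) = Real.pi := by
    rw [← Complex.ofReal_mul, div_mul_cancel₀ _ (by positivity)]
  have aux : ∀ s : ℝ, -Real.pi < s → s ≤ Real.pi →
      ((Real.cos (Real.pi / t) : ℂ) * Complex.exp (s * Complex.I)) ^ (t : ℂ) =
        (Real.cos (Real.pi / t) : ℂ) ^ (t : ℂ) * Complex.exp (s * t * Complex.I) := by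
    intro s h1 h2
    rw [Complex.cpow_def_of_ne_zero (mul_ne_zero (Complex.ofReal_ne_zero.mpr hc.ne')
      (Complex.exp_ne_zero _)), Complex.log_ofReal_mul hc (Complex.exp_ne_zero _),
      Complex.log_exp (by simpa using h1) (by simpa using h2),
      Complex.cpow_def_of_ne_zero (Complex.ofReal_ne_zero.mpr hc.ne'), ← Complex.exp_add,
      Complex.ofReal_log hc.le]
    congr 1
    ring
  constructor
  · rw [aux _ (by linarith) (by linarith), hmul, Complex.exp_pi_mul_I, mul_neg_one]
  · rw [← Complex.ofReal_neg, aux _ (by linarith) (by linarith), Complex.ofReal_neg, neg_mul, hmul,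
      neg_mul, Complex.exp_neg, Complex.exp_pi_mul_I, inv_neg, inv_one, mul_neg_one]

theorem exists_not_ballCongruent_isometricHFS (hd : 0 < d) {t : ℝ} [Fact (0 < t)] (ht : 2 < t) :
    ∃ A B : Set (UnitBall d), ¬ BallCongruent A B ∧
      IsometricHFS (kernelSubspace (BallSpace d t) A) (kernelSubspace (BallSpace d t) B) := by
  set θ := Real.pi / t with hθdef
  have hθ : 0 < θ := by positivity
  have hθ2 : θ < Real.pi / 2 := by rw [hθdef]; gcongr
  have hc : 0 < Real.cos θ := Real.cos_pos_of_mem_Ioo ⟨by linarith, hθ2⟩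
  have hσ : 0 < Real.sin θ := Real.sin_pos_of_pos_of_lt_pi hθ (by linarith)
  have hsc := Real.sin_sq_add_cos_sq θ
  have hσ1 : Real.sin θ < 1 := by nlinarith
  set σ := Real.sin θ with hσdef
  set κ := Real.cos θ with hκdef
  -- The norms of `b` and `a` are to be `s` and `r`, with product `σ = |1 - κ e^{-iθ}|`. The
  -- midpoint of `σ` and `1` gives `0 < r < s < 1`, hence unequal sides.
  set s := (1 + σ) / 2 with hs
  set r := 2 * σ / (1 + σ) with hr
  have hs0 : 0 < s := by positivity
  have hs1 : s < 1 := by rw [hs]; linarith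
  have hr0 : 0 < r := by positivity
  have hr1 : r < 1 := by rw [hr, div_lt_one (by positivity)]; linarith
  have hrs : r * s = σ := by rw [hr, hs]; field_simp
  have hne : r < s := by
    rw [hr, hs, div_lt_div_iff₀ (by positivity) (by positivity)]
    nlinarith [mul_pos (sub_pos.mpr hσ1) (sub_pos.mpr hσ1)]
  -- The unit vector with `1 - σζ = κ e^{-iθ}`. Both `a` and `b` lie on one coordinate axis, so `d =
  -- 1` is enough.
  set ζ : ℂ := σ + κ * Complex.I with hζ
  have hζn : ‖ζ‖ = 1 := by
    rw [hζ, Complex.norm_add_mul_I, hsc, Real.sqrt_one]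
  let i₀ : Fin d := ⟨0, hd⟩
  let o : UnitBall d := ⟨0, Metric.mem_ball_self zero_lt_one⟩
  let a : UnitBall d := ⟨EuclideanSpace.single i₀ (r : ℂ), by simpa [abs_of_pos hr0] using hr1⟩
  let b : UnitBall d := ⟨EuclideanSpace.single i₀ (s * ζ : ℂ), by
    simpa [hζn, abs_of_pos hs0] using hs1⟩
  have hna : ‖(a : EuclideanSpace ℂ (Fin d))‖ = r := by simp [a, abs_of_pos hr0]
  have hnb : ‖(b : EuclideanSpace ℂ (Fin d))‖ = s := by simp [b, hζn, abs_of_pos hs0]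
  have hab : ⟪(a : EuclideanSpace ℂ (Fin d)), (b : EuclideanSpace ℂ (Fin d))⟫_ℂ = σ * ζ := by
    rw [← hrs]
    simp only [a, b, EuclideanSpace.inner_single_left, PiLp.single_apply, if_true,
      Complex.conj_ofReal, Complex.ofReal_mul]
    ring
  have hexp : 1 - (σ : ℂ) * ζ = κ * Complex.exp (-θ * Complex.I) := by
    have hscC : (σ : ℂ) ^ 2 + (κ : ℂ) ^ 2 = 1 := by exact_mod_cast hsc
    rw [Complex.exp_mul_I, Complex.cos_neg, Complex.sin_neg, ← Complex.ofReal_cos,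
      ← Complex.ofReal_sin, ← hσdef, ← hκdef, hζ]
    linear_combination -hscC
  have hexp' : 1 - conj ((σ : ℂ) * ζ) = κ * Complex.exp (θ * Complex.I) := by
    have := congrArg conj hexp
    rw [map_sub, map_one, map_mul (starRingEnd ℂ) (κ : ℂ), Complex.conj_ofReal,
      ← Complex.exp_conj] at this
    simpa using this
  have hba : ⟪(b : EuclideanSpace ℂ (Fin d)), (a : EuclideanSpace ℂ (Fin d))⟫_ℂ =
      conj ((σ : ℂ) * ζ) := by rw [← hab, inner_conj_symm]
  have hK : ballKernel d t a b = ballKernel d t b a := by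
    obtain ⟨e1, e2⟩ := cos_mul_exp_cpow_pi_div ht
    rw [ballKernel, ballKernel, hab, hba, hexp, hexp', e1, e2]
  have ioa : ballInvariant o a = 1 - r ^ 2 := by simp [ballInvariant, o, hna]
  have iob : ballInvariant o b = 1 - s ^ 2 := by simp [ballInvariant, o, hnb]
  -- The denominator is `κ² = 1 - σ²` with `σ = rs`.
  have iab : ballInvariant a b = (1 - r ^ 2) * (1 - s ^ 2) / (1 - r ^ 2 * s ^ 2) := by
    have h1 : ‖(1 : ℂ) - conj ((σ : ℂ) * ζ)‖ = κ := by
      rw [hexp', norm_mul, Complex.norm_exp_ofReal_mul_I, mul_one, Complex.norm_real,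
        Real.norm_of_nonneg hc.le]
    rw [ballInvariant, hna, hnb, hba, h1, ← mul_pow, hrs, ← hsc, add_sub_cancel_left]
  have hr2 : r ^ 2 < 1 := by nlinarith
  have hs2 : s ^ 2 < 1 := by nlinarith
  have hr2' : 0 < r ^ 2 := by positivity
  have hs2' : 0 < s ^ 2 := by positivity
  have hrs2 : r ^ 2 < s ^ 2 := by gcongr
  have hden : 0 < 1 - r ^ 2 * s ^ 2 := by nlinarith
  refine ⟨{o, a, b}, mirror '' {o, a, b}, not_ballCongruent_mirror rfl ?_ ?_ ?_ ?_ ?_ ?_ ?_,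
    isometricHFS_mirror ?_⟩
  · rw [ioa]; linarith
  · rw [iob]; linarith
  · rw [iab, ne_eq, div_eq_one_iff_eq hden.ne']; nlinarith
  · rw [ioa, iob]; linarith
  -- Cancelling `1 - r²` would leave `1 - r²s² = 1 - s²`, impossible for `r < 1`; the next case is
  -- the same with `r` and `s` exchanged.
  · rw [ioa, iab, ne_eq, eq_div_iff hden.ne']
    intro h
    have := mul_left_cancel₀ (by linarith) h
    nlinarith
  · rw [iob, iab, ne_eq, eq_div_iff hden.ne', mul_comm (1 - r ^ 2)]
    intro h
    have := mul_left_cancel₀ (by linarith) h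
    nlinarith
  · rw [hab]
    intro h
    have := congrArg Complex.im h
    simp [hζ] at this
    have h2 := mul_pos hσ hc
    linarith
  · have hKo : ∀ x, ballKernel d t x o = ballKernel d t o x := fun x ↦ by simp [ballKernel, o]
    rintro x (rfl | rfl | rfl) y (rfl | rfl | rfl) <;>
      first
        | with_reducible rfl
        | with_reducible exact hKo _
        | with_reducible exact (hKo _).symm
        | with_reducible exact hK
        | with_reducible exact hK.symm

end MirrorImage

end

theorem theorem1p5 (d : ℕ) (hd : 0 < d) (t : ℝ) [Fact (0 < t)] :
    (t ≤ 2 → ∀ A B : Set (UnitBall d),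
      IsometricHFS (kernelSubspace (BallSpace d t) A) (kernelSubspace (BallSpace d t) B) ↔
        BallCongruent A B) ∧
    (2 < t → ∃ A B : Set (UnitBall d), ¬ BallCongruent A B ∧
      IsometricHFS (kernelSubspace (BallSpace d t) A) (kernelSubspace (BallSpace d t) B)) ∧
    (IsFaithful d t ↔ t ≤ 2) := by
  refine ⟨fun ht A B ↦ ⟨(isFaithful_of_le_two ht).ballCongruent, isometricHFS_of_ballCongruent⟩,
    exists_not_ballCongruent_isometricHFS hd, fun h ↦ ?_, isFaithful_of_le_two⟩
  by_contra! ht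
  obtain ⟨A, B, hAB, hiso⟩ := exists_not_ballCongruent_isometricHFS hd ht
  exact hAB (h.ballCongruent hiso)
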